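/- **Conventions.** A $k$-graph $H$ consists of a finite vertex set $V(H)$ and a set $E(H)$ of $k$-element subsets of $V(H)$. Its minimum vertex degree $\delta_1(H)$ is the minimum over $v\in V(H)$ of the number of edges containing $v$. A set $I\subseteq V(H)$ is independent if it contains no edge of $H$, and $\alpha(H)$ is the size of a largest independent set. For an integer $r\ge 0$, let $H_r^k=H+K_r^k$ be the $k$-graph obtained from $H$ by adding a set $Q$ of $r$ new vertices, whose edges are the edges of $H$ together with all $k$-element subsets of $V(H)\cup Q$ that meet $Q$. A fractional matching in a $k$-graph $G$ is a function $\varphi:E(G)\to[0,1]$ with $\sum_{e\ni v}\varphi(e)\le 1$ for every $v\in V(G)$; it is perfect if $\sum_{e\in E(G)}\varphi(e)=|V(G)|/k$. **Lemma.** Let $k\ge 3$ be an integer and let $\varepsilon,\rho$ be real constants with $0<\varepsilon\le (3^{k-2}\,k!\,k^3)^{-1}$ and $0<\rho<\varepsilon^4/k^8$. Then there is an integer $N=N(k,\varepsilon,\rho)$ such that the following holds for all non-negative integers $n,m,r$ with $$n\ge N,\qquad \frac{n}{2k^4}<m\le\frac{n-1}{2(k-1)}+1,\qquad (r-k)(k-1)\ge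 n-km .$$ If $H$ is a $k$-graph with $n$ vertices such that $$\alpha(H)<n-m-\varepsilon n\qquad\text{and}\qquad \delta_1(H)>\binom{n-1}{k-1}-\binom{n-m}{k-1}-\rho n^{k-1},$$ then $H_r^k$ has a perfect fractional matching. -/

import Mathlib

namespace Hypergraph

variable {α : Type*}

/-- `H` is a `k`-graph: every edge is a set of exactly `k` vertices. -/
def IsUniform (H : Hypergraph α) (k : ℕ) : Prop :=
  ∀ e ∈ H.edgeSet, e.encard = k

/-- An independent set: a set of vertices that contains no edge of `H`. -/
def IsIndependent (H : Hypergraph α) (I : Set α) : Prop :=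
  I ⊆ H.vertexSet ∧ ∀ e ∈ H.edgeSet, ¬ e ⊆ I

/-- The independence number `α(H)` of a hypergraph with finitely many vertices: the size of a
largest independent set. -/
noncomputable def indepNumber (H : Hypergraph α) : ℕ :=
  sSup {s : ℕ | ∃ I : Set α, H.IsIndependent I ∧ I.ncard = s}

/-- The degree of a vertex: the number of edges that contain it (for finite hypergraphs). -/
noncomputable def degree (H : Hypergraph α) (v : α) : ℕ :=
  {e : Set α | e ∈ H.edgeSet ∧ v ∈ e}.ncard

/-- The minimum vertex degree `δ₁(H)` of a hypergraph with a nonempty vertex set. -/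
noncomputable def minDegree (H : Hypergraph α) : ℕ :=
  sInf (H.degree '' H.vertexSet)

/-- The `k`-graph `H + K_r^k`: `r` new vertices are added to `H`, and the edges are those of `H`
together with all `k`-element sets of vertices that contain at least one new vertex. -/
def joinComplete (H : Hypergraph α) (k r : ℕ) : Hypergraph (α ⊕ Fin r) where
  vertexSet := Sum.inl '' H.vertexSet ∪ Set.range Sum.inr
  edgeSet := {e | ∃ f ∈ H.edgeSet, e = Sum.inl '' f} ∪
    {e | e ⊆ Sum.inl '' H.vertexSet ∪ Set.range Sum.inr ∧ e.encard = k ∧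
      (e ∩ Set.range Sum.inr).Nonempty}
  subset_vertexSet_of_mem_edgeSet' := by
    rintro e (⟨f, hf, rfl⟩ | he)
    · exact (Set.image_mono (H.subset_vertexSet_of_mem_edgeSet' hf)).trans
        Set.subset_union_left
    · exact he.1

/-- A fractional matching of a hypergraph with finitely many edges: a function from the edge set
to `[0, 1]` such that at every vertex the weights of the edges through it sum to at most one. -/
def IsFractionalMatching (H : Hypergraph α) (w : H.edgeSet → ℝ) : Prop :=
  (∀ e, 0 ≤ w e ∧ w e ≤ 1) ∧
    ∀ v ∈ H.vertexSet, ∑ᶠ (e : H.edgeSet) (_ : v ∈ (e : Set α)), w e ≤ 1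

/-- A fractional matching of a finite `k`-graph is perfect if its total weight is `|V(H)| / k`. -/
def HasPerfectFractionalMatching (H : Hypergraph α) (k : ℕ) : Prop :=
  ∃ w : H.edgeSet → ℝ, H.IsFractionalMatching w ∧
    ∑ᶠ e : H.edgeSet, w e = (H.vertexSet.ncard : ℝ) / k

end Hypergraph

/-! If there is no perfect fractional matching, linear programming duality gives weights on the old
and new vertices with positive sum on every edge and total zero. Each new vertex outweighs minus the
sum of any `k - 1` old ones, so shifting, scaling and truncating the old weights gives a fractional
cover `x` of `H` of weight less than `s = m - 1`, zero at some `v₀` (`exists_cover_of_dual`).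

As `x v₀ = 0`, every edge through `v₀` leaves a `(k-1)`-set of weight at least one, so the minimum
degree is at most the number of such heavy sets. Let `A` be the `s` heaviest vertices other than
`v₀`, `W` the remaining ones and `Y` the weight on `W`. By `card_heavy_add_choose_le`, with `j = k -
2`, heavy sets number at most those meeting `A`, minus a term linear in `Y`. Since `n - 1 - s = n -
m`, the degree hypothesis forces `k * Y ≤ ε * n`. Vertices of weight below `1 / k` form an
independent set missing at most `s + k * Y` vertices, against the bound on the independence number.
-/

namespace Finset

/-! ### Counting sets of weight at least one. -/

variable {V : Type*} [DecidableEq V]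

/-- A separating threshold `h` is available even when `G` or `S \ G` is empty. Applied to `-x`, this
selects the heaviest vertices. -/
theorem exists_lowest_subset (S : Finset V) (f : V → ℝ) {j : ℕ} (hj : j ≤ #S) :
    ∃ G ⊆ S, #G = j ∧ ∃ h : ℝ, (∀ v ∈ G, f v ≤ h) ∧ ∀ v ∈ S \ G, h ≤ f v := by
  have key : ∃ G ⊆ S, #G = j ∧ ∀ v ∈ G, ∀ u ∈ S \ G, f v ≤ f u := by
    induction j with
    | zero => exact ⟨∅, by simp, by simp, by simp⟩
    | succ j ih =>
      obtain ⟨G, hGS, hGj, hG⟩ := ih (by omega)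
      have hne : (S \ G).Nonempty := by
        rw [← card_pos, card_sdiff_of_subset hGS]; omega
      obtain ⟨u, hu, hmin⟩ := exists_min_image (S \ G) f hne
      have huS := mem_sdiff.1 hu
      refine ⟨insert u G, insert_subset huS.1 hGS, by rw [card_insert_of_notMem huS.2, hGj], ?_⟩
      intro v hv z hz
      simp only [mem_sdiff, mem_insert, not_or] at hz hv
      have hz' : z ∈ S \ G := mem_sdiff.2 ⟨hz.1, hz.2.2⟩
      rcases hv with rfl | hv
      · exact hmin z hz'
      · exact hG v hv z hz'
  obtain ⟨G, hGS, hGj, hG⟩ := key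
  refine ⟨G, hGS, hGj, ?_⟩
  rcases (S \ G).eq_empty_or_nonempty with he | hne
  · rcases G.eq_empty_or_nonempty with rfl | hGne
    · exact ⟨0, by simp, by simp [he]⟩
    · obtain ⟨u, -, hu⟩ := exists_max_image G f hGne
      exact ⟨f u, hu, by simp [he]⟩
  · obtain ⟨u, hu, hmin⟩ := exists_min_image (S \ G) f hne
    exact ⟨f u, fun v hv => hG v hv u hu, hmin⟩

theorem card_filter_mem_powersetCard {W : Finset V} {v : V} (hv : v ∈ W) (j : ℕ) :
    #{T ∈ powersetCard (j + 1) W | v ∈ T} = (#W - 1).choose j := by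
  rw [← card_erase_of_mem hv, ← card_powersetCard]
  refine card_bij' (fun T _ => T.erase v) (fun T _ => insert v T) ?_ ?_ ?_ ?_
  · intro T hT
    simp only [mem_filter, mem_powersetCard] at hT ⊢
    exact ⟨erase_subset_erase v hT.1.1, by rw [card_erase_of_mem hT.2, hT.1.2]; rfl⟩
  · intro T hT
    simp only [mem_filter, mem_powersetCard] at hT ⊢
    have hvT : v ∉ T := fun h => by simpa using hT.1 h
    exact ⟨⟨insert_subset hv (hT.1.trans (erase_subset _ _)),
      by rw [card_insert_of_notMem hvT, hT.2]⟩, mem_insert_self _ _⟩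
  · intro T hT
    exact insert_erase (mem_filter.1 hT).2
  · intro T hT
    have hvT : v ∉ T := fun h => by simpa using (mem_powersetCard.1 hT).1 h
    exact erase_insert hvT

theorem card_mul_sum_powersetCard_sum (W : Finset V) (x : V → ℝ) (j : ℕ) :
    (#W : ℝ) * ∑ T ∈ powersetCard j W, ∑ v ∈ T, x v = j * (#W).choose j * ∑ v ∈ W, x v := by
  cases j with
  | zero => simp
  | succ j =>
    have h1 : ∑ T ∈ powersetCard (j + 1) W, ∑ v ∈ T, x v
        = ((#W - 1).choose j : ℝ) * ∑ v ∈ W, x v := by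
      rw [sum_comm' (s' := fun v => {T ∈ powersetCard (j + 1) W | v ∈ T}) (t' := W), mul_sum]
      · refine sum_congr rfl fun v hv => ?_
        rw [sum_const, card_filter_mem_powersetCard hv, nsmul_eq_mul]
      · intro T v
        simp only [mem_powersetCard, mem_filter]
        exact ⟨fun h => ⟨h, h.1.1 h.2⟩, fun h => h.1⟩
    rw [h1]
    rcases W.eq_empty_or_nonempty with rfl | hne
    · simp
    · obtain ⟨w, hw⟩ : ∃ w, #W = w + 1 := ⟨#W - 1, by have := hne.card_pos; omega⟩
      have h2 := Nat.add_one_mul_choose_eq w j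
      rw [hw, Nat.add_sub_cancel, ← mul_assoc]
      congr 1
      rw [mul_comm ((j + 1 : ℕ) : ℝ)]
      exact_mod_cast h2

/-- A fractional version of Katona's bound on the size of a family by the size of its shadow. -/
theorem card_heavy_le_sum_mul_card (W : Finset V) (x : V → ℝ) (a : ℝ) (j : ℕ)
    (hx : ∀ v ∈ W, 0 ≤ x v) (hW : ∀ v ∈ W, x v ≤ a) :
    (#{T ∈ powersetCard (j + 1) W | 1 ≤ ∑ v ∈ T, x v} : ℝ)
      ≤ (∑ v ∈ W, x v) * #{G ∈ powersetCard j W | 1 ≤ a + ∑ v ∈ G, x v} := by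
  set F := {T ∈ powersetCard (j + 1) W | 1 ≤ ∑ v ∈ T, x v} with hF
  set B := {G ∈ powersetCard j W | 1 ≤ a + ∑ v ∈ G, x v} with hB
  calc (#F : ℝ) = ∑ T ∈ F, (1 : ℝ) := by simp
    _ ≤ ∑ T ∈ F, ∑ v ∈ T, x v := sum_le_sum fun T hT => (mem_filter.1 hT).2
    _ = ∑ v ∈ W, ∑ T ∈ F with v ∈ T, x v := by
        refine sum_comm' fun T v => ?_
        simp only [hF, mem_powersetCard, mem_filter]
        exact ⟨fun h => ⟨h, h.1.1.1 h.2⟩, fun h => h.1⟩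
    -- For fixed `v`, deleting `v` maps heavy sets containing it injectively into `B`, because `x v
    -- ≤ a`.
    _ ≤ ∑ v ∈ W, x v * #B := by
        refine sum_le_sum fun v hv => ?_
        rw [sum_const, nsmul_eq_mul, mul_comm]
        refine mul_le_mul_of_nonneg_left ?_ (hx v hv)
        norm_cast
        refine card_le_card_of_injOn (fun T => T.erase v) ?_ ?_
        · intro T hT
          simp only [hF, hB, coe_filter, mem_filter, mem_powersetCard, Set.mem_ofPred_eq] at hT ⊢
          obtain ⟨⟨⟨hTW, hTc⟩, hT1⟩, hvT⟩ := hT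
          refine ⟨⟨(erase_subset _ _).trans hTW, by rw [card_erase_of_mem hvT, hTc]; rfl⟩, ?_⟩
          rw [← add_sum_erase T x hvT] at hT1
          linarith [hW v hv]
        · intro T hT T' hT' h
          have h1 := (mem_filter.1 (mem_coe.1 hT)).2
          have h2 := (mem_filter.1 (mem_coe.1 hT')).2
          rw [← insert_erase h1, ← insert_erase h2]
          exact congrArg (insert v) h
    _ = _ := by rw [sum_mul]

/-- Counts only the light sets meeting `A` in at most one vertex; a pair `(v, G)` encodes `insert v
G`. -/
theorem card_light_add_card_light_pairs_le (A W : Finset V) (hAW : Disjoint A W) (x : V → ℝ)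
    (j : ℕ) :
    #{T ∈ powersetCard (j + 1) W | ∑ v ∈ T, x v < 1}
        + #{p ∈ A ×ˢ powersetCard j W | x p.1 + ∑ v ∈ p.2, x v < 1}
      ≤ #{T ∈ powersetCard (j + 1) (A ∪ W) | ∑ v ∈ T, x v < 1} := by
  have hnot : ∀ v ∈ A, ∀ G ⊆ W, v ∉ G := fun v hv G hG h => disjoint_left.1 hAW hv (hG h)
  have himg : #(image (fun p : V × Finset V => insert p.1 p.2)
      {p ∈ A ×ˢ powersetCard j W | x p.1 + ∑ v ∈ p.2, x v < 1})
      = #{p ∈ A ×ˢ powersetCard j W | x p.1 + ∑ v ∈ p.2, x v < 1} := by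
    refine card_image_of_injOn ?_
    rintro ⟨v, G⟩ hp ⟨v', G'⟩ hp' h
    simp only [coe_filter, mem_product, mem_powersetCard, Set.mem_ofPred_eq] at hp hp' h
    have hvv : v = v' := by
      have : v ∈ insert v' G' := h ▸ mem_insert_self v G
      rcases mem_insert.1 this with h1 | h1
      · exact h1
      · exact absurd h1 (hnot v hp.1.1 G' hp'.1.2.1)
    subst hvv
    have : G = G' := by
      rw [← erase_insert (hnot v hp.1.1 G hp.1.2.1), h,
        erase_insert (hnot v hp.1.1 G' hp'.1.2.1)]
    rw [this]
  rw [← himg, ← card_union_of_disjoint]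
  · refine card_le_card (union_subset ?_ ?_)
    · intro T hT
      simp only [mem_filter, mem_powersetCard] at hT ⊢
      exact ⟨⟨hT.1.1.trans subset_union_right, hT.1.2⟩, hT.2⟩
    · intro T hT
      simp only [mem_image, mem_filter, mem_product, mem_powersetCard] at hT ⊢
      obtain ⟨⟨v, G⟩, ⟨⟨hv, hG, hGc⟩, hlt⟩, rfl⟩ := hT
      have hvG := hnot v hv G hG
      refine ⟨⟨insert_subset (mem_union_left _ hv) (hG.trans subset_union_right), ?_⟩, ?_⟩
      · rw [card_insert_of_notMem hvG, hGc]
      · rwa [sum_insert hvG]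
  · rw [disjoint_left]
    intro T hT hT'
    simp only [mem_image, mem_filter, mem_product, mem_powersetCard] at hT hT'
    obtain ⟨⟨v, G⟩, ⟨⟨hv, -, -⟩, -⟩, rfl⟩ := hT'
    exact disjoint_left.1 hAW hv (hT.1.1 (mem_insert_self _ _))

/-- A stability bound for the number of sets of size `j + 1` and weight at least one, where `A`
holds the heaviest vertices and the total weight is less than `#A`. -/
theorem card_heavy_add_choose_le (A W : Finset V) (hAW : Disjoint A W) (x : V → ℝ) (a : ℝ)
    (j : ℕ) (ha0 : 0 ≤ a) (hx : ∀ v ∈ W, 0 ≤ x v) (hA : ∀ v ∈ A, a ≤ x v)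
    (hW : ∀ v ∈ W, x v ≤ a) (hw : (2 * j + 1) * #A ≤ #W)
    (hsum : ∑ v ∈ A, x v + ∑ v ∈ W, x v < #A) :
    (#{T ∈ powersetCard (j + 1) (A ∪ W) | 1 ≤ ∑ v ∈ T, x v} : ℝ) + (#W).choose (j + 1)
        + (#W).choose j * (∑ v ∈ W, x v) / (2 * j + 1) ≤ (#A + #W).choose (j + 1) := by
  set X := ∑ v ∈ A, x v with hX
  set Y := ∑ v ∈ W, x v with hY
  set C := ((#W).choose j : ℝ) with hC
  set K := ∑ G ∈ powersetCard j W, ∑ v ∈ G, x v with hK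
  set F := {T ∈ powersetCard (j + 1) W | 1 ≤ ∑ v ∈ T, x v} with hF
  set B := {G ∈ powersetCard j W | 1 ≤ a + ∑ v ∈ G, x v} with hB
  set P := A ×ˢ powersetCard j W with hP
  set good := {p ∈ P | x p.1 + ∑ v ∈ p.2, x v < 1} with hgood
  set bad := {p ∈ P | ¬ (x p.1 + ∑ v ∈ p.2, x v < 1)} with hbad
  have hY0 : 0 ≤ Y := sum_nonneg hx
  have hX0 : #A * a ≤ X := by
    have := sum_le_sum hA
    simpa using this
  have hs : (0 : ℝ) < #A := by
    have : 0 ≤ X := le_trans (by positivity) hX0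
    linarith
  have ha1 : a < 1 := by
    by_contra h
    push Not at h
    nlinarith
  have hwR : (2 * j + 1) * (#A : ℝ) ≤ #W := by exact_mod_cast hw
  have hj0 : (0 : ℝ) ≤ j := by positivity
  have hw0 : (0 : ℝ) < #W := by nlinarith
  have hGnn : ∀ G ∈ powersetCard j W, 0 ≤ ∑ v ∈ G, x v := fun G hG =>
    sum_nonneg fun v hv => hx v ((mem_powersetCard.1 hG).1 hv)
  have hK0 : 0 ≤ K := sum_nonneg hGnn
  have hC0 : 0 ≤ C := by positivity
  have hwK : (#W : ℝ) * K = j * C * Y := card_mul_sum_powersetCard_sum W x j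
  have hFB : (#F : ℝ) ≤ Y * #B := card_heavy_le_sum_mul_card W x a j hx hW
  have hBK : (1 - a) * #B ≤ K := by
    calc (1 - a) * (#B : ℝ) = ∑ G ∈ B, (1 - a) := by rw [sum_const, nsmul_eq_mul, mul_comm]
      _ ≤ ∑ G ∈ B, ∑ v ∈ G, x v :=
        sum_le_sum fun G hG => by linarith [(mem_filter.1 hG).2]
      _ ≤ K := sum_le_sum_of_subset_of_nonneg (filter_subset _ _) fun G hG _ => hGnn G hG
  -- Markov's inequality: on a bad pair the excess `x v - a` plus the weight of `G` is at least `1 -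
  -- a`.
  have hbadle : (1 - a) * #bad ≤ (X - #A * a) * C + #A * K := by
    calc (1 - a) * (#bad : ℝ) = ∑ p ∈ bad, (1 - a) := by rw [sum_const, nsmul_eq_mul, mul_comm]
      _ ≤ ∑ p ∈ bad, ((x p.1 - a) + ∑ v ∈ p.2, x v) :=
        sum_le_sum fun p hp => by linarith [not_lt.1 (mem_filter.1 hp).2]
      _ ≤ ∑ p ∈ P, ((x p.1 - a) + ∑ v ∈ p.2, x v) := by
        refine sum_le_sum_of_subset_of_nonneg (filter_subset _ _) fun p hp _ => ?_
        have hp := mem_product.1 hp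
        exact add_nonneg (by linarith [hA _ hp.1]) (hGnn _ hp.2)
      _ = _ := by
        rw [hP, sum_product]
        simp only [sum_add_distrib, sum_const, card_powersetCard, nsmul_eq_mul, ← mul_sum,
          sum_sub_distrib]
        ring
  have hgb : (#good : ℝ) + #bad = #A * C := by
    have := card_filter_add_card_filter_not (s := P) (fun p => x p.1 + ∑ v ∈ p.2, x v < 1)
    rw [hC]
    have h2 : #P = #A * (#W).choose j := by rw [hP, card_product, card_powersetCard]
    rw [h2] at this
    exact_mod_cast this
  -- The size condition on `W` enters here: it keeps the loss `2 * #A * K` below the gain `Y * C`,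
  -- leaving the fraction `1 / (2 * j + 1)`.
  have hsK : (2 * j + 1) * (#A * K) ≤ j * C * Y := by
    rw [← hwK]; nlinarith
  have hYK : Y * K ≤ #A * K := mul_le_mul_of_nonneg_right (by nlinarith) hK0
  have hD : C * Y / (2 * j + 1) ≤ #good - #F := by
    have h1 : C * Y / (2 * j + 1) ≤ (1 - a) * (#good - #F) := by
      rw [div_le_iff₀ (by positivity)]
      have e1 : (1 - a) * (#F : ℝ) ≤ Y * K := by
        calc (1 - a) * (#F : ℝ) ≤ (1 - a) * (Y * #B) :=
              mul_le_mul_of_nonneg_left hFB (by linarith)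
          _ = Y * ((1 - a) * #B) := by ring
          _ ≤ Y * K := mul_le_mul_of_nonneg_left hBK hY0
      have e2 : (#A - X) * C - #A * K ≤ (1 - a) * #good := by
        have : (#good : ℝ) = #A * C - #bad := by linarith
        rw [this]; linarith
      have e3 : Y * C ≤ (#A - X) * C := mul_le_mul_of_nonneg_right (by linarith) hC0
      have e4 : Y * C - 2 * (#A * K) ≤ (1 - a) * (#good - #F) := by linarith
      have e5 := mul_le_mul_of_nonneg_right e4 (show (0 : ℝ) ≤ 2 * j + 1 by positivity)
      linarith
    have h0 : 0 ≤ C * Y / (2 * j + 1) := by positivity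
    have h2 : 0 ≤ (#good - #F : ℝ) := by
      by_contra h
      push Not at h
      nlinarith
    nlinarith
  have hlight := card_light_add_card_light_pairs_le A W hAW x j
  have hFl := card_filter_add_card_filter_not (s := powersetCard (j + 1) W)
    (fun T => 1 ≤ ∑ v ∈ T, x v)
  have hLl := card_filter_add_card_filter_not (s := powersetCard (j + 1) (A ∪ W))
    (fun T => 1 ≤ ∑ v ∈ T, x v)
  simp only [not_le, card_powersetCard, card_union_of_disjoint hAW] at hFl hLl
  have c1 : (#F : ℝ) + #{T ∈ powersetCard (j + 1) W | ∑ v ∈ T, x v < 1}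
      = (#W).choose (j + 1) := by exact_mod_cast hFl
  have c2 : (#{T ∈ powersetCard (j + 1) (A ∪ W) | 1 ≤ ∑ v ∈ T, x v} : ℝ)
      + #{T ∈ powersetCard (j + 1) (A ∪ W) | ∑ v ∈ T, x v < 1}
      = (#A + #W).choose (j + 1) := by exact_mod_cast hLl
  have c3 : (#{T ∈ powersetCard (j + 1) W | ∑ v ∈ T, x v < 1} : ℝ) + #good
      ≤ #{T ∈ powersetCard (j + 1) (A ∪ W) | ∑ v ∈ T, x v < 1} := by exact_mod_cast hlight
  linarith

end Finset

/-! ### Linear programming duality. -/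

namespace Hypergraph

open Finset

/-- Linear programming duality for perfect fractional matchings. -/
theorem hasPerfectFractionalMatching_of_dual {β : Type*} (G : Hypergraph β) (k : ℕ) (hk : 0 < k)
    (U : Finset β) (hU : G.vertexSet = U) (hUne : U.Nonempty) (hG : G.IsUniform k)
    (hdual : ∀ y : β → ℝ, (∀ T : Finset β, (T : Set β) ∈ G.edgeSet → 0 < ∑ v ∈ T, y v) →
      ∑ v ∈ U, y v ≠ 0) :
    G.HasPerfectFractionalMatching k := by
  classical
  have hsub : ∀ e ∈ G.edgeSet, e ⊆ (U : Set β) := fun e he =>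
    hU ▸ G.subset_vertexSet_of_mem_edgeSet' he
  have hfin : G.edgeSet.Finite := U.finite_toSet.finite_subsets.subset hsub
  have : Fintype G.edgeSet := hfin.fintype
  have hcard : ∀ e ∈ G.edgeSet, #{v ∈ U | v ∈ e} = k := by
    intro e he
    have h1 := hG e he
    have h2 : ((({v ∈ U | v ∈ e} : Finset β)) : Set β) = e := by
      ext v
      simp only [coe_filter]
      exact ⟨fun h => h.2, fun h => ⟨hsub e he h, h⟩⟩
    rw [← h2, Set.encard_coe_eq_coe_finsetCard] at h1
    exact_mod_cast h1
  have hn : (0 : ℝ) < #U := by exact_mod_cast hUne.card_pos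
  have hkR : (0 : ℝ) < k := by exact_mod_cast hk
  set b : G.edgeSet → β → ℝ := fun e => ∑ v ∈ U with v ∈ (e : Set β), Pi.single v 1 with hb
  have hbv : ∀ (e : G.edgeSet), ∀ v, b e v = if v ∈ (e : Set β) then 1 else 0 := by
    intro e v
    simp only [hb, Finset.sum_apply, Pi.single_apply, sum_ite_eq, mem_filter]
    refine if_congr ⟨fun h => h.2, fun h => ⟨hsub e e.2 h, h⟩⟩ rfl rfl
  -- The constant vector on `U` with coordinate sum `k`, as for each edge indicator `b e`. A perfect
  -- fractional matching is a rescaled convex combination of the `b e` equal to `p`.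
  set p : β → ℝ := ((k : ℝ) / #U) • ∑ v ∈ U, Pi.single v 1 with hp
  set Φ := Fintype.linearCombination ℝ b with hΦ
  set K := Φ '' stdSimplex ℝ G.edgeSet with hK
  have hKconv : Convex ℝ K := (convex_stdSimplex ℝ _).linear_image Φ
  have hKclosed : IsClosed K :=
    ((isCompact_stdSimplex ℝ _).image (LinearMap.continuous_of_finiteDimensional Φ)).isClosed
  by_cases hpK : p ∈ K
  · obtain ⟨w, ⟨hw0, hw1⟩, hwp⟩ := hpK
    have hsum : ∀ v ∈ U, ∑ e : G.edgeSet, (if v ∈ (e : Set β) then w e else 0) = k / #U := by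
      intro v hv
      have h := congrFun hwp v
      simp only [hΦ, Fintype.linearCombination_apply, Finset.sum_apply, Pi.smul_apply, hbv, hp,
        Pi.single_apply, sum_ite_eq, hv, if_true, smul_eq_mul, mul_ite, mul_one, mul_zero] at h
      exact h
    have hsum' : ∀ v ∈ U,
        ∑ e : G.edgeSet, (if v ∈ (e : Set β) then (#U : ℝ) / k * w e else 0) = 1 := by
      intro v hv
      have h := hsum v hv
      calc _ = (#U : ℝ) / k * ∑ e : G.edgeSet, (if v ∈ (e : Set β) then w e else 0) := by
            rw [mul_sum]; exact sum_congr rfl fun e _ => by split_ifs <;> simp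
        _ = 1 := by rw [h]; field_simp
    have hnn : ∀ e, 0 ≤ (#U : ℝ) / k * w e := fun e => mul_nonneg (by positivity) (hw0 e)
    refine ⟨fun e => (#U : ℝ) / k * w e, ⟨fun e => ⟨hnn e, ?_⟩, ?_⟩, ?_⟩
    · have hne : #{v ∈ U | v ∈ (e : Set β)} ≠ 0 := by rw [hcard e e.2]; omega
      obtain ⟨v, hv⟩ := card_ne_zero.1 hne
      have hv := mem_filter.1 hv
      rw [← hsum' v hv.1]
      have := single_le_sum (f := fun e : G.edgeSet =>
        if v ∈ (e : Set β) then (#U : ℝ) / k * w e else 0) (s := univ)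
        (fun i _ => by split_ifs; exacts [hnn i, le_rfl]) (mem_univ e)
      simpa only [hv.2, if_true] using this
    · intro v hv
      rw [hU] at hv
      rw [finsum_eq_sum_of_fintype]
      simp only [finsum_eq_if]
      exact (hsum' v hv).le
    · rw [finsum_eq_sum_of_fintype, ← mul_sum, hw1, hU, Set.ncard_coe_finset, mul_one]
  · obtain ⟨f, u, hfp, hf⟩ := geometric_hahn_banach_point_closed hKconv hKclosed hpK
    exfalso
    have hfpv : f p = (k : ℝ) / #U * ∑ v ∈ U, f (Pi.single v 1) := by
      rw [hp, map_smul, map_sum, smul_eq_mul]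
    -- The shift by `f p / k` makes the total vanish and edge sums equal `f (b e) - f p`.
    refine hdual (fun v => f (Pi.single v 1) - f p / k) (fun T hT => ?_) ?_
    · have hbK : b ⟨T, hT⟩ ∈ K :=
        ⟨Pi.single ⟨T, hT⟩ 1, single_mem_stdSimplex ℝ _, by
          simp [hΦ, Fintype.linearCombination_apply_single]⟩
      have h1 := hf _ hbK
      have hTU : ({v ∈ U | v ∈ (T : Set β)} : Finset β) = T := by
        ext v
        simp only [mem_filter, mem_coe]
        exact ⟨fun h => h.2, fun h => ⟨hsub _ hT h, h⟩⟩
      have hTc : #T = k := by rw [← hTU]; convert hcard _ hT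
      have h2 : f (b ⟨T, hT⟩) = ∑ v ∈ T, f (Pi.single v 1) := by
        simp only [hb, map_sum, hTU]
      rw [sum_sub_distrib, sum_const, hTc, nsmul_eq_mul, mul_div_cancel₀ _ hkR.ne']
      linarith
    · rw [sum_sub_distrib, sum_const, nsmul_eq_mul, hfpv]
      field_simp
      ring

end Hypergraph

/-! ### From a dual solution to a fractional cover. -/

namespace Finset

variable {V : Type*} [DecidableEq V]

theorem sum_pos_of_forall_card_eq (S : Finset V) (g : V → ℝ) {k : ℕ} (hk : k ≤ #S)
    (hg : ∀ T ⊆ S, #T = k → 0 < ∑ v ∈ T, g v) : 0 < ∑ v ∈ S, g v := by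
  obtain ⟨G, hGS, hGk, h, hle, hge⟩ := S.exists_lowest_subset g hk
  have hpos := hg G hGS hGk
  have h1 : 0 < h := by
    by_contra hh
    exact absurd hpos (not_lt.2 (sum_nonpos fun v hv => (hle v hv).trans (not_lt.1 hh)))
  rw [← sum_sdiff hGS]
  exact add_pos_of_nonneg_of_pos (sum_nonneg fun v hv => h1.le.trans (hge v hv)) hpos

/-- Shifts, scales and truncates the dual weights `f` on the old vertices and `g` on the new ones
to a fractional cover of weight less than `m - 1` that vanishes at some old vertex. -/
theorem exists_cover_of_dual (S : Finset V) (k m r : ℕ) (hk : 3 ≤ k) (hkr : k ≤ r)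
    (hn : k ^ 2 ≤ #S) (hr : (#S : ℝ) - k * m ≤ (r - k) * (k - 1)) (f : V → ℝ) (g : Fin r → ℝ)
    (hQ : ∀ T : Finset (Fin r), #T = k → 0 < ∑ q ∈ T, g q)
    (hmix : ∀ q, ∀ G ⊆ S, #G = k - 1 → 0 < g q + ∑ v ∈ G, f v)
    (hsum : ∑ v ∈ S, f v + ∑ q, g q = 0) :
    ∃ x : V → ℝ, ∃ v₀ ∈ S, (∀ v, 0 ≤ x v) ∧ x v₀ = 0 ∧ ∑ v ∈ S, x v < m - 1 ∧
      ∀ T ⊆ S, #T = k → 0 < ∑ v ∈ T, f v → 1 ≤ ∑ v ∈ T, x v := by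
  have hkS : k - 1 ≤ #S := by nlinarith [Nat.sub_le k 1]
  have hk1 : ((k - 1 : ℕ) : ℝ) = k - 1 := by push_cast [Nat.cast_sub (by omega : 1 ≤ k)]; ring
  have hkR : (3 : ℝ) ≤ k := by exact_mod_cast hk
  have hnR : (k : ℝ) ^ 2 ≤ #S := by exact_mod_cast hn
  have hrR : (0 : ℝ) < r := by exact_mod_cast (by omega : 0 < r)
  obtain ⟨G, hGS, hGk, h, hle, hge⟩ := S.exists_lowest_subset f hkS
  have hGne : G.Nonempty := card_pos.1 (by omega)
  have hGkR : (#G : ℝ) = k - 1 := by rw [hGk, hk1]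
  -- `-σ` is the average over the `k - 1` lowest vertices, so by `hmix` every new vertex has weight
  -- above `(k - 1) * σ`.
  obtain ⟨σ, hσ⟩ : ∃ σ : ℝ, ∑ v ∈ G, f v = -((k - 1) * σ) :=
    ⟨-(∑ v ∈ G, f v) / (k - 1), by field_simp [show (k : ℝ) - 1 ≠ 0 by linarith]⟩
  have hGh : ∑ v ∈ G, f v ≤ (k - 1) * h := by
    have := sum_le_card_nsmul G f h hle
    rwa [nsmul_eq_mul, hGkR] at this
  have hSh : ∑ v ∈ G, f v + (#S - (k - 1)) * h ≤ ∑ v ∈ S, f v := by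
    have := card_nsmul_le_sum (S \ G) f h hge
    rw [nsmul_eq_mul, card_sdiff_of_subset hGS, Nat.cast_sub (card_le_card hGS), hGkR] at this
    rw [← sum_sdiff hGS]
    linarith
  have hQpos : 0 < ∑ q, g q :=
    sum_pos_of_forall_card_eq univ g (by simpa using hkr) fun T _ hT => hQ T hT
  have hσ0 : 0 < σ := by
    by_contra hneg
    push Not at hneg
    have h1 : 0 ≤ ∑ v ∈ G, f v := by rw [hσ]; nlinarith
    have h2 : 0 ≤ h := by
      by_contra hh
      push Not at hh
      nlinarith
    have h3 : 0 ≤ (#S - (k - 1)) * h := mul_nonneg (by nlinarith) h2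
    linarith
  have hQsum : r * ((k - 1) * σ) < ∑ q, g q := by
    have : ∑ _q : Fin r, (k - 1) * σ < ∑ q, g q := by
      refine sum_lt_sum_of_nonempty ⟨⟨0, by omega⟩, mem_univ _⟩ fun q _ => ?_
      have := hmix q G hGS hGk
      linarith
    simpa using this
  have hhσ : -σ ≤ h := by
    by_contra hh
    push Not at hh
    nlinarith
  have hconst : ∑ _v ∈ G, -σ = ∑ v ∈ G, f v := by
    rw [sum_const, nsmul_eq_mul, hGkR, hσ]; ring
  obtain ⟨v₀, hv₀, hfv₀⟩ := exists_le_of_sum_le hGne hconst.ge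
  obtain ⟨v₁, hv₁, hfv₁⟩ := exists_le_of_sum_le hGne hconst.le
  -- A lower value would force `h` above `2 * σ / (k - 2)`; with at least `k ^ 2` old vertices their
  -- total would then be positive.
  have hlow : ∀ v ∈ G, -((k + 1) * σ) ≤ f v := by
    intro v hv
    by_contra hlt
    push Not at hlt
    have h1 : ∑ u ∈ G.erase v, f u ≤ (k - 2) * h := by
      have := sum_le_card_nsmul (G.erase v) f h fun u hu => hle u (mem_of_mem_erase hu)
      rw [nsmul_eq_mul, card_erase_of_mem hv, Nat.cast_sub hGne.card_pos, hGkR] at this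
      push_cast at this
      linarith
    have h2 := add_sum_erase G f hv
    have h3 : 2 * σ < (k - 2) * h := by linarith
    have h4 : 0 < h := by
      by_contra hh
      push Not at hh
      nlinarith
    have h5 : (k - 1) * (k - 2) * h ≤ 2 * ((#S - (k - 1)) * h) := by
      rw [← mul_assoc]
      refine mul_le_mul_of_nonneg_right ?_ h4.le
      nlinarith
    have h6 : (k - 1) * (2 * σ) ≤ (k - 1) * ((k - 2) * h) :=
      mul_le_mul_of_nonneg_left h3.le (by linarith)
    have h7 : 0 ≤ (k - 1) * σ := mul_nonneg (by linarith) hσ0.le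
    have h8 : 0 ≤ r * ((k - 1) * σ) := by positivity
    linarith
  have hkσ : 0 < k * σ := by positivity
  refine ⟨fun v => max ((f v + σ) / (k * σ)) 0, v₀, hGS hv₀, fun v => le_max_right _ _,
    max_eq_right (div_nonpos_of_nonpos_of_nonneg (by linarith) hkσ.le), ?_, ?_⟩
  -- Truncation raises only vertices of `G` other than `v₁`, each by at most one, hence by at most
  -- `k - 2` in total; before it the sum is below `m - k + 1`.
  · have hx : ∀ v ∈ S, max ((f v + σ) / (k * σ)) 0
        ≤ (f v + σ) / (k * σ) + if v ∈ G.erase v₁ then 1 else 0 := by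
      intro v hv
      by_cases hvG : v ∈ G.erase v₁
      · rw [if_pos hvG]
        have h1 : -1 ≤ (f v + σ) / (k * σ) := by
          rw [le_div_iff₀ hkσ]; linarith [hlow v (mem_of_mem_erase hvG)]
        exact max_le (by linarith) (by linarith)
      · rw [if_neg hvG, add_zero]
        refine max_le le_rfl (div_nonneg ?_ hkσ.le)
        by_cases hv1 : v = v₁
        · rw [hv1]; linarith
        · have : v ∉ G := fun hG => hvG (mem_erase.2 ⟨hv1, hG⟩)
          linarith [hge v (mem_sdiff.2 ⟨hv, this⟩)]
    refine (sum_le_sum hx).trans_lt ?_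
    have hone : ∑ v ∈ S, (if v ∈ G.erase v₁ then (1 : ℝ) else 0) = k - 2 := by
      rw [sum_ite_mem, inter_eq_right.2 ((erase_subset _ _).trans hGS), sum_const,
        card_erase_of_mem hv₁, nsmul_eq_mul, Nat.cast_sub hGne.card_pos, hGkR]
      push_cast; ring
    rw [sum_add_distrib, hone, ← sum_div, sum_add_distrib, sum_const, nsmul_eq_mul]
    have h1 : (∑ v ∈ S, f v + #S * σ) / (k * σ) < m - k + 1 := by
      rw [div_lt_iff₀ hkσ]
      nlinarith
    linarith
  · intro T _ hT hpos
    have h1 : 1 ≤ ∑ v ∈ T, (f v + σ) / (k * σ) := by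
      rw [← sum_div, le_div_iff₀ hkσ, sum_add_distrib, sum_const, hT, nsmul_eq_mul]
      linarith
    exact h1.trans (sum_le_sum fun v _ => le_max_left _ _)

end Finset

/-! ### Covers, minimum degree and independence number. -/

namespace Hypergraph

open Finset

theorem ncard_le_indepNumber {V : Type*} (H : Hypergraph V) (hfin : H.vertexSet.Finite)
    {I : Set V} (hI : H.IsIndependent I) : I.ncard ≤ H.indepNumber := by
  refine le_csSup ⟨H.vertexSet.ncard, ?_⟩ ⟨I, hI, rfl⟩
  rintro _ ⟨J, hJ, rfl⟩
  exact Set.ncard_le_ncard hJ.1 hfin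

theorem degree_le_card_heavy {V : Type*} [DecidableEq V] (H : Hypergraph V) (j : ℕ)
    (S : Finset V) (hS : H.vertexSet = S) (hH : H.IsUniform (j + 2)) (x : V → ℝ) (v : V)
    (hxv : x v = 0)
    (hcov : ∀ T : Finset V, (T : Set V) ∈ H.edgeSet → 1 ≤ ∑ u ∈ T, x u) :
    H.degree v ≤ #{T ∈ powersetCard (j + 1) (S.erase v) | 1 ≤ ∑ u ∈ T, x u} := by
  rw [← Set.ncard_coe_finset]
  refine le_trans (Set.ncard_le_ncard ?_ (Set.toFinite _))
    (Set.ncard_image_le (f := fun T : Finset V => ((insert v T : Finset V) : Set V))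
      (finite_toSet _))
  rintro e ⟨he, hve⟩
  have heS : e ⊆ S := hS ▸ H.subset_vertexSet_of_mem_edgeSet' he
  obtain ⟨T, rfl⟩ := (S.finite_toSet.subset heS).exists_finset_coe
  have hvT : v ∈ T := hve
  have hTc : #T = j + 2 := by
    have := hH _ he
    rw [Set.encard_coe_eq_coe_finsetCard] at this
    exact_mod_cast this
  refine ⟨T.erase v, ?_, congrArg _ (insert_erase hvT)⟩
  simp only [coe_filter, mem_powersetCard, Set.mem_ofPred_eq]
  refine ⟨⟨erase_subset_erase v (coe_subset.1 heS), by rw [card_erase_of_mem hvT, hTc]; rfl⟩, ?_⟩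
  have h1 := hcov T he
  rwa [← add_sum_erase T x hvT, hxv, zero_add] at h1

/-- If a fractional cover of weight less than `s` vanishes somewhere, then a minimum degree close
to the maximum possible forces an independent set of almost `|V(H)| - s` vertices. -/
theorem exists_minDegree_le_and_le_indepNumber {V : Type*} (H : Hypergraph V) (j s : ℕ)
    (S : Finset V) (hS : H.vertexSet = S) (hH : H.IsUniform (j + 2)) (x : V → ℝ) (v₀ : V)
    (hv₀ : v₀ ∈ S) (hx : ∀ v, 0 ≤ x v) (hx0 : x v₀ = 0) (hsum : ∑ v ∈ S, x v < s)
    (hcov : ∀ T : Finset V, (T : Set V) ∈ H.edgeSet → 1 ≤ ∑ u ∈ T, x u)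
    (hs : 2 * (j + 1) * s ≤ #S - 1) :
    ∃ Y : ℝ, (H.minDegree : ℝ) + (#S - 1 - s).choose (j + 1)
        + (#S - 1 - s).choose j * Y / (2 * j + 1) ≤ (#S - 1).choose (j + 1) ∧
      (#S : ℝ) - s - (j + 2) * Y ≤ H.indepNumber := by
  classical
  have hcS : #(S.erase v₀) = #S - 1 := card_erase_of_mem hv₀
  have hS1 : 1 ≤ #S := card_pos.2 ⟨v₀, hv₀⟩
  have hsle : s ≤ #S - 1 := by nlinarith
  obtain ⟨A, hAS, hAs, h, hle, hge⟩ :=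
    (S.erase v₀).exists_lowest_subset (fun v => -x v) (hcS ▸ hsle)
  set W := S.erase v₀ \ A with hW
  have hWc : #W = #S - 1 - s := by rw [hW, card_sdiff_of_subset hAS, hcS, hAs]
  have hAW : A ∪ W = S.erase v₀ := union_sdiff_of_subset hAS
  have hdisj : Disjoint A W := disjoint_sdiff
  have hsum' : ∑ v ∈ A, x v + ∑ v ∈ W, x v = ∑ v ∈ S, x v := by
    rw [← sum_union hdisj, hAW, ← add_sum_erase S x hv₀, hx0, zero_add]
  -- The maximum with `0` ensures `0 ≤ a` without a sign condition on `h`.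
  have hcore := card_heavy_add_choose_le A W hdisj x (max (-h) 0) j (le_max_right _ _)
    (fun v _ => hx v) (fun v hv => max_le (by linarith [hle v hv]) (hx v))
    (fun v hv => le_max_of_le_left (by linarith [hge v hv]))
    (by
      rw [hAs, hWc]
      have : 2 * (j + 1) * s = (2 * j + 1) * s + s := by ring
      omega)
    (by rw [hsum', hAs]; exact hsum)
  rw [hAW, hWc, hAs, Nat.add_sub_cancel' hsle] at hcore
  refine ⟨∑ v ∈ W, x v, ?_, ?_⟩
  · have h1 : H.minDegree ≤ H.degree v₀ := Nat.sInf_le ⟨v₀, by rw [hS]; exact hv₀, rfl⟩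
    have h2 : (H.minDegree : ℝ)
        ≤ #{T ∈ powersetCard (j + 1) (S.erase v₀) | 1 ≤ ∑ u ∈ T, x u} := by
      exact_mod_cast h1.trans (H.degree_le_card_heavy j S hS hH x v₀ hx0 hcov)
    linarith
  · set I := {v ∈ S | x v < 1 / (j + 2)} with hI
    have hj : (0 : ℝ) < j + 2 := by positivity
    have hind : H.IsIndependent (I : Set V) := by
      refine ⟨by rw [hS]; exact coe_subset.2 (filter_subset _ _), fun e he heI => ?_⟩
      obtain ⟨T, rfl⟩ := (I.finite_toSet.subset heI).exists_finset_coe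
      have hTc : #T = j + 2 := by
        have := hH _ he
        rw [Set.encard_coe_eq_coe_finsetCard] at this
        exact_mod_cast this
      have h1 : ∑ u ∈ T, x u < ∑ _u ∈ T, (1 : ℝ) / (j + 2) :=
        sum_lt_sum_of_nonempty (card_pos.1 (by omega)) fun u hu =>
          (mem_filter.1 (coe_subset.1 heI hu)).2
      rw [sum_const, hTc, nsmul_eq_mul] at h1
      push_cast at h1
      rw [mul_one_div_cancel hj.ne'] at h1
      linarith [hcov T he]
    have hIle := H.ncard_le_indepNumber (by rw [hS]; exact S.finite_toSet) hind
    rw [Set.ncard_coe_finset] at hIle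
    set R := {v ∈ W | 1 / (j + 2) ≤ x v} with hR
    have hRY : (#R : ℝ) ≤ (j + 2) * ∑ v ∈ W, x v := by
      have h1 : ∑ _v ∈ R, (1 : ℝ) / (j + 2) ≤ ∑ v ∈ W, x v :=
        (sum_le_sum fun v hv => (mem_filter.1 hv).2).trans
          (sum_le_sum_of_subset_of_nonneg (filter_subset _ _) fun v _ _ => hx v)
      rw [sum_const, nsmul_eq_mul, mul_one_div, div_le_iff₀ hj] at h1
      linarith
    have hcover : S ⊆ I ∪ A ∪ R := by
      intro v hv
      by_cases h1 : x v < 1 / (j + 2)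
      · exact mem_union_left _ (mem_union_left _ (mem_filter.2 ⟨hv, h1⟩))
      · have hne : v ≠ v₀ := by
          rintro rfl
          exact h1 (by rw [hx0]; positivity)
        have h2 : v ∈ A ∪ W := hAW ▸ mem_erase.2 ⟨hne, hv⟩
        rcases mem_union.1 h2 with h3 | h3
        · exact mem_union_left _ (mem_union_right _ h3)
        · exact mem_union_right _ (mem_filter.2 ⟨h3, not_lt.1 h1⟩)
    have hcount : #S ≤ #I + #A + #R :=
      (card_le_card hcover).trans ((card_union_le _ _).trans
        (Nat.add_le_add_right (card_union_le _ _) _))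
    rw [hAs] at hcount
    have h1 : (#S : ℝ) ≤ #I + s + #R := by exact_mod_cast hcount
    have h2 : (#I : ℝ) ≤ H.indepNumber := by exact_mod_cast hIle
    linarith

theorem isUniform_joinComplete {V : Type*} {H : Hypergraph V} {k : ℕ} (hH : H.IsUniform k)
    (r : ℕ) : (H.joinComplete k r).IsUniform k := by
  rintro e (⟨f, hf, rfl⟩ | he)
  · rw [Sum.inl_injective.encard_image, hH f hf]
  · exact he.2.1

/-- If `H + K_r^k` has no perfect fractional matching, then `H` has a fractional cover of weight
less than `m - 1` that vanishes at some vertex. -/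
theorem exists_cover_of_not_hasPerfectFractionalMatching {V : Type*} (H : Hypergraph V)
    (k m r : ℕ) (hk : 3 ≤ k) (hkr : k ≤ r) (S : Finset V) (hS : H.vertexSet = S)
    (hH : H.IsUniform k) (hn : k ^ 2 ≤ #S) (hr : (#S : ℝ) - k * m ≤ (r - k) * (k - 1))
    (hno : ¬ (H.joinComplete k r).HasPerfectFractionalMatching k) :
    ∃ x : V → ℝ, ∃ v₀ ∈ S, (∀ v, 0 ≤ x v) ∧ x v₀ = 0 ∧ ∑ v ∈ S, x v < m - 1 ∧
      ∀ T : Finset V, (T : Set V) ∈ H.edgeSet → 1 ≤ ∑ v ∈ T, x v := by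
  classical
  have hU : (H.joinComplete k r).vertexSet = (S.disjSum univ : Finset (V ⊕ Fin r)) := by
    ext (v | q) <;> simp [joinComplete, hS]
  have hdual : ¬ ∀ y : V ⊕ Fin r → ℝ,
      (∀ T : Finset (V ⊕ Fin r), (T : Set (V ⊕ Fin r)) ∈ (H.joinComplete k r).edgeSet →
        0 < ∑ v ∈ T, y v) → ∑ v ∈ S.disjSum univ, y v ≠ 0 := fun h =>
    hno (hasPerfectFractionalMatching_of_dual _ k (by omega) _ hU
      ⟨Sum.inr ⟨0, by omega⟩, by simp⟩ (isUniform_joinComplete hH r) h)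
  push Not at hdual
  obtain ⟨y, hy, hy0⟩ := hdual
  have hnew : ∀ (G : Finset V) (T : Finset (Fin r)), G ⊆ S → T.Nonempty → #G + #T = k →
      0 < ∑ v ∈ G, y (Sum.inl v) + ∑ q ∈ T, y (Sum.inr q) := by
    intro G T hGS ⟨q, hq⟩ hc
    rw [← sum_disjSum]
    refine hy _ (Or.inr ⟨?_, ?_, ⟨Sum.inr q, ?_, q, rfl⟩⟩)
    · rintro (v | p) hv
      · left
        simp only [mem_coe, inl_mem_disjSum] at hv
        exact ⟨v, by rw [hS]; exact hGS hv, rfl⟩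
      · exact Or.inr ⟨p, rfl⟩
    · rw [Set.encard_coe_eq_coe_finsetCard, card_disjSum, hc]
    · simpa using hq
  rw [sum_disjSum] at hy0
  obtain ⟨x, v₀, hv₀, hx, hx0, hsum, hcov⟩ := exists_cover_of_dual S k m r hk hkr hn hr
    (fun v => y (Sum.inl v)) (fun q => y (Sum.inr q))
    (fun T hT => by
      simpa using hnew ∅ T (empty_subset _) (card_pos.1 (by omega)) (by simpa using hT))
    (fun q G hG hGk => by
      have := hnew G {q} hG (singleton_nonempty q) (by rw [card_singleton]; omega)
      rwa [sum_singleton, add_comm] at this) hy0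
  refine ⟨x, v₀, hv₀, hx, hx0, hsum, fun T hT => hcov T ?_ ?_ ?_⟩
  · rw [← coe_subset, ← hS]; exact H.subset_vertexSet_of_mem_edgeSet' hT
  · have := hH _ hT
    rw [Set.encard_coe_eq_coe_finsetCard] at this
    exact_mod_cast this
  · have := hy (T.map Function.Embedding.inl) (Or.inl ⟨_, hT, by simp⟩)
    simpa using this

end Hypergraph

/-! ### Constants and conclusion. -/

theorem le_mul_of_mul_lt_of_lt_pow_div (j : ℕ) (ε ρ n Y : ℝ) (hε0 : 0 < ε)
    (hε : ε ≤ ((3 : ℝ) ^ j * ((j + 2).factorial : ℝ) * ((j + 2 : ℕ) : ℝ) ^ 3)⁻¹)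
    (hρ0 : 0 < ρ) (hρ : ρ < ε ^ 4 / ((j + 2 : ℕ) : ℝ) ^ 8) (hnR : 0 < n)
    (hY : (n / 2) ^ j / (j.factorial : ℝ) * Y / (2 * j + 1) < ρ * n ^ (j + 1)) :
    (j + 2) * Y ≤ ε * n := by
  set D : ℝ := 2 ^ j * j.factorial with hD
  have hD0 : 0 < D := by positivity
  have hY' : Y < (2 * j + 1) * D * ρ * n := by
    have h1 : (n / 2) ^ j / (j.factorial : ℝ) * Y / (2 * j + 1)
        = n ^ j * (Y / (D * (2 * j + 1))) := by
      rw [hD, div_pow]; field_simp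
    rw [h1, pow_succ, show ρ * (n ^ j * n) = n ^ j * (ρ * n) by ring,
      mul_lt_mul_iff_right₀ (by positivity), div_lt_iff₀ (by positivity)] at hY
    linarith
  have hk8 : ((j + 2 : ℕ) : ℝ) ^ 8 * ρ ≤ ε ^ 4 := by
    rw [lt_div_iff₀ (by positivity)] at hρ; linarith
  set M : ℝ := (3 : ℝ) ^ j * ((j + 2).factorial : ℝ) * ((j + 2 : ℕ) : ℝ) ^ 3 with hM
  have hM0 : 0 < M := by positivity
  have hεM : ε * M ≤ 1 := by
    have := mul_le_mul_of_nonneg_right hε hM0.le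
    rwa [inv_mul_cancel₀ hM0.ne'] at this
  have hDM : D ≤ M := by
    have h1 : (1 : ℝ) ≤ ((j + 2 : ℕ) : ℝ) ^ 3 :=
      one_le_pow₀ (by exact_mod_cast (by omega : 1 ≤ j + 2))
    have h2 : (j.factorial : ℝ) ≤ ((j + 2).factorial : ℝ) := by
      exact_mod_cast Nat.factorial_le (by omega)
    have h3 : (2 : ℝ) ^ j ≤ 3 ^ j := by
      gcongr; norm_num
    calc D ≤ 3 ^ j * ((j + 2).factorial : ℝ) := by rw [hD]; gcongr
      _ ≤ M := le_mul_of_one_le_right (by positivity) h1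
  have hM1 : 1 ≤ M := by
    refine le_trans ?_ hDM
    exact one_le_mul_of_one_le_of_one_le (one_le_pow₀ (by norm_num))
      (by exact_mod_cast j.factorial_pos)
  have hε1 : ε ≤ 1 := by nlinarith
  have hεD : ε * D ≤ 1 := (mul_le_mul_of_nonneg_left hDM hε0.le).trans hεM
  have hjk : ((j : ℝ) + 2) * (2 * j + 1) ≤ ((j + 2 : ℕ) : ℝ) ^ 8 := by
    push_cast
    calc ((j : ℝ) + 2) * (2 * j + 1) ≤ (j + 2) ^ 3 := by
          have : (0 : ℝ) ≤ j := by positivity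
          nlinarith [pow_nonneg this 3, sq_nonneg (j : ℝ)]
      _ ≤ (j + 2) ^ 8 := pow_le_pow_right₀ (by
          have : (0 : ℝ) ≤ j := by positivity
          linarith) (by norm_num)
  have hε2 : ε ^ 4 ≤ ε ^ 2 := pow_le_pow_of_le_one hε0.le hε1 (by norm_num)
  -- One factor `ε` will absorb `D = 2 ^ j * j!`; the other is the bound sought.
  have hcρ : ((j : ℝ) + 2) * (2 * j + 1) * ρ ≤ ε ^ 2 :=
    (mul_le_mul_of_nonneg_right hjk hρ0.le).trans (hk8.trans hε2)
  calc (j + 2) * Y ≤ (j + 2) * ((2 * j + 1) * D * ρ * n) := by gcongr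
    _ = ((j : ℝ) + 2) * (2 * j + 1) * ρ * D * n := by ring
    _ ≤ ε ^ 2 * D * n := by gcongr
    _ = ε * (ε * D) * n := by ring
    _ ≤ ε * 1 * n := by gcongr
    _ = ε * n := by ring

theorem lemma2p3 (k : ℕ) (hk : 3 ≤ k) (ε ρ : ℝ)
    (hε0 : 0 < ε) (hε : ε ≤ ((3 : ℝ) ^ (k - 2) * (Nat.factorial k : ℝ) * (k : ℝ) ^ 3)⁻¹)
    (hρ0 : 0 < ρ) (hρ : ρ < ε ^ 4 / (k : ℝ) ^ 8) :
    ∃ N : ℕ, ∀ n m r : ℕ, N ≤ n →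
      (n : ℝ) / (2 * (k : ℝ) ^ 4) < (m : ℝ) →
      (m : ℝ) ≤ ((n : ℝ) - 1) / (2 * ((k : ℝ) - 1)) + 1 →
      (n : ℤ) - (k : ℤ) * (m : ℤ) ≤ ((r : ℤ) - (k : ℤ)) * ((k : ℤ) - 1) →
      ∀ (V : Type*) (H : Hypergraph V), H.IsUniform k → H.vertexSet.ncard = n →
        (H.indepNumber : ℝ) < (n : ℝ) - (m : ℝ) - ε * (n : ℝ) →
        ((n - 1).choose (k - 1) : ℝ) - ((n - m).choose (k - 1) : ℝ)
            - ρ * (n : ℝ) ^ (k - 1) < (H.minDegree : ℝ) →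
        (H.joinComplete k r).HasPerfectFractionalMatching k := by
  refine ⟨4 * k ^ 2, fun n m r hnN hm0 hm hr V H hH hn hα hδ => ?_⟩
  by_contra hno
  obtain ⟨j, rfl⟩ : ∃ j, k = j + 2 := ⟨k - 2, by omega⟩
  have hn0 : 0 < n := lt_of_lt_of_le (by positivity) hnN
  have hnR : (0 : ℝ) < n := by exact_mod_cast hn0
  have hm1 : 1 ≤ m := by
    have : (0 : ℝ) < m := lt_of_le_of_lt (by positivity) hm0
    exact_mod_cast this
  obtain ⟨s, rfl⟩ : ∃ s, m = s + 1 := ⟨m - 1, by omega⟩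
  have hfin : H.vertexSet.Finite := Set.finite_of_ncard_pos (by omega)
  obtain ⟨S, hS⟩ := hfin.exists_finset_coe
  have hSn : S.card = n := by rw [← hn, ← hS, Set.ncard_coe_finset]
  have hs : 2 * (j + 1) * s ≤ n - 1 := by
    push_cast at hm
    have h1 : (s : ℝ) ≤ (n - 1) / (2 * (j + 1)) := by
      have : (j : ℝ) + 2 - 1 = j + 1 := by ring
      rw [this] at hm; linarith
    rw [le_div_iff₀ (by positivity)] at h1
    have h2 : 2 * (j + 1) * s + 1 ≤ n := by
      have : (2 * (j + 1) * s + 1 : ℝ) ≤ n := by linarith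
      exact_mod_cast this
    omega
  have hj1 : 1 ≤ j := by omega
  have hs4 : 4 * s ≤ n - 1 := le_trans (Nat.mul_le_mul_right s (by omega)) hs
  have hnk : 4 * (j + 2) ≤ n := le_trans (by nlinarith) hnN
  -- Otherwise the left side of `hr` is nonnegative, as `k * m ≤ n`, while the right side is
  -- negative.
  have hkr : j + 2 ≤ r := by
    by_contra hlt
    have h1 : ((r : ℤ) - (j + 2 : ℕ)) * ((j + 2 : ℕ) - 1) ≤ -(j + 1) := by
      have : (r : ℤ) - (j + 2 : ℕ) ≤ -1 := by omega
      push_cast at this ⊢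
      nlinarith
    have h2 : (j + 2) * (s + 1) ≤ n := by
      have e1 : (j + 2) * (s + 1) = (j + 1) * s + s + (j + 2) := by ring
      have e2 : 2 * (j + 1) * s = 2 * ((j + 1) * s) := by ring
      omega
    have h3 : ((j + 2 : ℕ) : ℤ) * ((s + 1 : ℕ) : ℤ) ≤ n := by exact_mod_cast h2
    linarith
  have hrR : (S.card : ℝ) - (j + 2 : ℕ) * (s + 1 : ℕ) ≤ (r - (j + 2 : ℕ)) * ((j + 2 : ℕ) - 1) := by
    rw [hSn]; exact_mod_cast hr
  obtain ⟨x, v₀, hv₀, hx, hx0, hsum, hcov⟩ :=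
    H.exists_cover_of_not_hasPerfectFractionalMatching (j + 2) (s + 1) r hk hkr S hS.symm hH
      (by rw [hSn]; exact le_trans (by nlinarith) hnN) hrR hno
  obtain ⟨Y, hdeg, hind⟩ := H.exists_minDegree_le_and_le_indepNumber j s S hS.symm hH x v₀ hv₀ hx
    hx0 (by push_cast at hsum; linarith) hcov (by rw [hSn]; exact hs)
  rw [hSn] at hdeg hind
  have e1 : j + 2 - 1 = j + 1 := rfl
  rw [e1, show n - (s + 1) = n - 1 - s by omega] at hδ
  -- Both `s` and `j` are at most about `n / 4`, so each factor of the falling factorial is at least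
  -- `n / 2`.
  have hC : ((n : ℝ) / 2) ^ j / (j.factorial : ℝ) ≤ (n - 1 - s).choose j := by
    refine le_trans ?_ (Nat.pow_le_choose (α := ℝ) j (n - 1 - s))
    refine div_le_div_of_nonneg_right (pow_le_pow_left₀ (by positivity) ?_ j) (by positivity)
    rw [div_le_iff₀ two_pos]
    have : n ≤ (n - 1 - s + 1 - j) * 2 := by omega
    exact_mod_cast this
  have hYρ : ((n : ℝ) / 2) ^ j / (j.factorial : ℝ) * Y / (2 * j + 1) < ρ * n ^ (j + 1) ∨ Y < 0 := by
    rcases lt_or_ge Y 0 with hY | hY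
    · exact Or.inr hY
    · left
      calc _ ≤ ((n - 1 - s).choose j : ℝ) * Y / (2 * j + 1) := by gcongr
        _ < _ := by linarith
  have hεn : (j + 2) * Y ≤ ε * n := by
    rcases hYρ with hY | hY
    · exact le_mul_of_mul_lt_of_lt_pow_div j ε ρ n Y hε0 hε hρ0 hρ hnR hY
    · have : (j + 2) * Y ≤ 0 := mul_nonpos_of_nonneg_of_nonpos (by positivity) hY.le
      exact this.trans (by positivity)
  push_cast at hα
  linarith
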